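/- Let $n\ge 1$, let $B_2^n$ be the closed Euclidean unit ball of $\mathbb R^n$ and $S^{n-1}$ its boundary. Let $f:\mathbb R^n\to\mathbb R$ be an integrable log-concave function (i.e. $f=e^{-v}$ with $v:\mathbb R^n\to(-\infty,+\infty]$ convex) with $\|f\|_\infty:=\sup f>0$. For $t>0$ put $K_t=K_t(f)=\{x: f(x)\ge t\|f\|_\infty\}$. For $a>0$ and an ellipsoid $\mathcal E=c+TB_2^n$ ($c\in\mathbb R^n$, $T\in GL(n)$) put $\mathcal E^a=a\chi_{\mathcal E}$. The John ellipsoid $\mathcal E(f)$ of $f$ is the function $\mathcal E^a$ of largest integral among those with $\mathcal E^a\le f$ (assertion 1 below includes that the maximum is attained). For $K\subseteq\mathbb R^n$ let $r(K)$ be the supremum of all $\rho\ge 0$ with $\rho B_2^n\subseteq K$, with $r(K)=0$ if there is no such $\rho$; the one-sided derivatives of $t\mapsto r(K_t)$ below are taken in $[-\infty,+\infty]$ (so for $t_0=1$ the right derivative is $-\infty$, because $K_t=\emptyset$ for $t>1$). Let $t_0\in(0,1]$ and assume that $(B_2^n)^{t_0\|f\|_\infty}\le f$. Then the following are equivalent: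 1. $\mathcal E(f)=(B_2^n)^{t_0\|f\|_\infty}$. 2. There exist integers $m$ and $m'(1),\dots,m'(m)$ with $1\le m\le 1+\frac{n(n+3)}2$ and $n\le m'(i)\le\frac{n(n+3)}2$ for all $1\le i\le m$, points $u_{ij}\in\partial K_{t_0}\cap S^{n-1}$ and numbers $\lambda_i>0$, $\mu_{ij}>0$ ($1\le i\le m$, $1\le j\le m'(i)$), and numbers $$\alpha_i\in\left[\,t_0\left.\tfrac{d}{dt^+}r(K_t)\right|_{t=t_0},\ t_0\left.\tfrac{d}{dt^-}r(K_t)\right|_{t=t_0}\right]$$ (both one-sided derivatives existing), such that $$\sum_{i=1}^m\lambda_i\alpha_i=-1,\qquad \sum_{i=1}^m\sum_{j=1}^{m'(i)}\lambda_i\mu_{ij}u_{ij}=0,\qquad I_n=\sum_{i=1}^m\sum_{j=1}^{m'(i)}\lambda_i\mu_{ij}\,u_{ij}\otimes u_{ij},$$ and such that for every $t\in(0,1]$, every $1\le i\le m$, every $c\in\mathbb R^n$ and every $T\in GL(n)$ with $c+TB_2^n\subseteq K_t(f)$, $$-\alpha_i\log\left(\frac t{t_0}\right)+\sum_{j=1}^{m'(i)}\mu_{ij}\langle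 c,u_{ij}\rangle+\sum_{j=1}^{m'(i)}\mu_{ij}\langle Tu_{ij},u_{ij}\rangle\le\sum_{j=1}^{m'(i)}\mu_{ij}.$$ 3. The same as 2, with the last inequality required only for symmetric positive definite $T$. -/

import Mathlib

open MeasureTheory Filter Topology Set

noncomputable section

namespace FunctionalJohn

/-- Log-concavity of `f : ℝⁿ → ℝ`: `f = exp (-v)` with `v` convex and values in `(-∞, +∞]`,
i.e. `f ≥ 0` and `f x ^ a * f y ^ b ≤ f (a x + b y)` for `a, b > 0`, `a + b = 1`. -/
def LogConcave {n : ℕ} (f : EuclideanSpace ℝ (Fin n) → ℝ) : Prop :=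
  (∀ x, 0 ≤ f x) ∧
    ∀ x y : EuclideanSpace ℝ (Fin n), ∀ a b : ℝ, 0 < a → 0 < b → a + b = 1 →
      f x ^ a * f y ^ b ≤ f (a • x + b • y)

/-- `‖f‖_∞` for a nonnegative function `f`. -/
def supNorm {n : ℕ} (f : EuclideanSpace ℝ (Fin n) → ℝ) : ℝ := ⨆ x, f x

/-- The level set `K_t(f) = {x : f x ≥ t ‖f‖_∞}`. -/
def levelSet {n : ℕ} (f : EuclideanSpace ℝ (Fin n) → ℝ) (t : ℝ) :
    Set (EuclideanSpace ℝ (Fin n)) :=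
  {x | t * supNorm f ≤ f x}

/-- The set `c + T B_2^n`. It is an ellipsoid when `T` is invertible. -/
def ellipsoid {n : ℕ} (c : EuclideanSpace ℝ (Fin n)) (T : Matrix (Fin n) (Fin n) ℝ) :
    Set (EuclideanSpace ℝ (Fin n)) :=
  (fun x => c + Matrix.toEuclideanLin T x) '' Metric.closedBall 0 1

/-- The function `S^a = a χ_S`. -/
def charFn {n : ℕ} (a : ℝ) (S : Set (EuclideanSpace ℝ (Fin n))) :
    EuclideanSpace ℝ (Fin n) → ℝ :=
  S.indicator fun _ => a

/-- Ellipsoidal functions `(c + T B_2^n)^a` with `a > 0` and `T ∈ GL(n)`. -/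
def IsEllipsoidal {n : ℕ} (g : EuclideanSpace ℝ (Fin n) → ℝ) : Prop :=
  ∃ (a : ℝ) (c : EuclideanSpace ℝ (Fin n)) (T : Matrix (Fin n) (Fin n) ℝ),
    0 < a ∧ T.det ≠ 0 ∧ g = charFn a (ellipsoid c T)

/-- `g` is an ellipsoidal function below `f` of maximal integral. -/
def IsMaximalEllipsoidal {n : ℕ} (f g : EuclideanSpace ℝ (Fin n) → ℝ) : Prop :=
  IsEllipsoidal g ∧ (∀ x, g x ≤ f x) ∧
    ∀ h : EuclideanSpace ℝ (Fin n) → ℝ, IsEllipsoidal h → (∀ x, h x ≤ f x) →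
      ∫ x, h x ≤ ∫ x, g x

open Classical in
/-- John's ellipsoid `ℰ(f)` of `f`: the ellipsoidal function below `f` of maximal integral
(and the zero function, which is not ellipsoidal, if there is no such function). -/
def johnEllipsoid {n : ℕ} (f : EuclideanSpace ℝ (Fin n) → ℝ) :
    EuclideanSpace ℝ (Fin n) → ℝ :=
  if h : ∃ g, IsMaximalEllipsoidal f g then h.choose else 0

/-- The inner radius `r(K)`: the radius of the largest centred Euclidean ball contained in `K`
(with `r(K) = 0` if there is none). -/
def innerRadius {n : ℕ} (K : Set (EuclideanSpace ℝ (Fin n))) : ℝ :=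
  sSup {ρ : ℝ | 0 ≤ ρ ∧ Metric.closedBall 0 ρ ⊆ K}

/-- `g` has right derivative `d ∈ [-∞, +∞]` at `t`. -/
def HasRightDeriv (g : ℝ → ℝ) (d : EReal) (t : ℝ) : Prop :=
  Tendsto (fun s : ℝ => (((g s - g t) / (s - t) : ℝ) : EReal)) (𝓝[>] t) (𝓝 d)

/-- `g` has left derivative `d ∈ [-∞, +∞]` at `t`. -/
def HasLeftDeriv (g : ℝ → ℝ) (d : EReal) (t : ℝ) : Prop :=
  Tendsto (fun s : ℝ => (((g s - g t) / (s - t) : ℝ) : EReal)) (𝓝[<] t) (𝓝 d)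

/-- The existence of contact points `u i j`, weights `lam i`, `mu i j` and numbers `α i` which
characterizes John's position of `f` at level `t₀`; the final inequality is required for the
ellipsoids `c + T B_2^n ⊆ K_t(f)` with `T` in the class `𝒯` of matrices. -/
def ContactDecomposition {n : ℕ} (f : EuclideanSpace ℝ (Fin n) → ℝ) (t₀ : ℝ)
    (𝒯 : Set (Matrix (Fin n) (Fin n) ℝ)) : Prop :=
  ∃ (m : ℕ) (m' : Fin m → ℕ) (u : (i : Fin m) → Fin (m' i) → EuclideanSpace ℝ (Fin n))
    (lam : Fin m → ℝ) (mu : (i : Fin m) → Fin (m' i) → ℝ) (α : Fin m → ℝ) (dR dL : EReal),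
    (1 ≤ m ∧ m ≤ 1 + n * (n + 3) / 2) ∧
    (∀ i, n ≤ m' i ∧ m' i ≤ n * (n + 3) / 2) ∧
    (∀ i j, u i j ∈ frontier (levelSet f t₀) ∩ Metric.sphere 0 1) ∧
    (∀ i, 0 < lam i) ∧
    (∀ i j, 0 < mu i j) ∧
    HasRightDeriv (fun t => innerRadius (levelSet f t)) dR t₀ ∧
    HasLeftDeriv (fun t => innerRadius (levelSet f t)) dL t₀ ∧
    (∀ i, (t₀ : EReal) * dR ≤ (α i : EReal) ∧ (α i : EReal) ≤ (t₀ : EReal) * dL) ∧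
    ∑ i, lam i * α i = -1 ∧
    ∑ i, ∑ j, (lam i * mu i j) • u i j = 0 ∧
    (1 : Matrix (Fin n) (Fin n) ℝ) =
      ∑ i, ∑ j, (lam i * mu i j) • Matrix.vecMulVec (u i j).ofLp (u i j).ofLp ∧
    ∀ t : ℝ, 0 < t → t ≤ 1 → ∀ i : Fin m, ∀ (c : EuclideanSpace ℝ (Fin n)), ∀ T ∈ 𝒯,
      ellipsoid c T ⊆ levelSet f t →
        -α i * Real.log (t / t₀) + ∑ j, mu i j * inner ℝ c (u i j)
          + ∑ j, mu i j * inner ℝ (Matrix.toEuclideanLin T (u i j)) (u i j) ≤ ∑ j, mu i j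

end FunctionalJohn

end

/-! All three statements come down to one linear inequality: log (t / t₀) + tr T ≤ n whenever c + T
B ⊆ K_t. For positive definite T the logarithm of the integral is, up to a constant, log t + log det
T, and the inequality is its linearisation at (t₀, I).

Maximality gives the inequality (`IsMaximalEllipsoidal.log_add_trace_le`): by log-concavity the
interpolants between the unit ball at height t₀ and the ellipsoid at height t stay below f, and the
volume bound is differentiated along them. At t = t₀ it reads tr T ≤ n, and Hahn–Banach with
Carathéodory turns this into a John decomposition of I / n over contact points of K_{t₀}
(`exists_john_decomposition`). One family, with λ = n and α = -1/n, then works. This α is admissible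
because τ ↦ r(K_{exp τ}) is concave up to the height of f at the origin and lies below exp ((log t₀
- τ) / n), touching it at τ = log t₀.

Conversely, adding the contact inequalities with weights λ_i recovers the linear inequality
(`ContactDecomposition.log_add_trace_le`). Polar decomposition and log det P ≤ tr P - n make the
ball a maximiser. As `johnEllipsoid` is an arbitrary choice among maximisers, uniqueness is needed
too: equality forces P = I and t = t₀, and a centre c ≠ 0 would produce an ellipsoid of trace above
n. -/

/-! ### Convex hulls and affine independence -/

/-- In a finite-dimensional space the convex hull of a compact set is compact. -/
theorem IsCompact.convexHull_of_finiteDimensional {E : Type*} [NormedAddCommGroup E]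
    [NormedSpace ℝ E] [FiniteDimensional ℝ E] {s : Set E} (hs : IsCompact s) :
    IsCompact (convexHull ℝ s) := by
  -- Carathéodory's number: the hull is the continuous image of a compact set of d weights and d
  -- points.
  let d := Module.finrank ℝ E + 1
  let F : (Fin d → ℝ) × (Fin d → E) → E := fun p => ∑ i, p.1 i • p.2 i
  have hF : Continuous F := by fun_prop
  have hc : IsCompact (F '' (stdSimplex ℝ (Fin d) ×ˢ Set.univ.pi fun _ => s)) :=
    ((isCompact_stdSimplex ℝ (Fin d)).prod (isCompact_univ_pi fun _ => hs)).image hF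
  convert hc using 1
  apply Set.Subset.antisymm
  · intro x hx
    obtain ⟨ι, _, z, w, hz, hind, hw, hw1, rfl⟩ := eq_pos_convex_span_of_mem_convexHull hx
    have hcard : Fintype.card ι ≤ Fintype.card (Fin d) := by
      simpa [d] using hind.card_le_finrank_succ.trans
        (Nat.succ_le_succ (Submodule.finrank_le _))
    obtain ⟨e⟩ := Function.Embedding.nonempty_of_card_le hcard
    have hne : Nonempty ι := by
      by_contra h
      rw [not_nonempty_iff] at h
      simp at hw1
    obtain ⟨i₀⟩ := hne
    -- A shorter combination is padded to length d with zero weights and copies of one of its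
    -- points.
    have hext : ∀ (g : ι → ℝ) (y : ι → E),
        ∑ i, Function.extend e g 0 i • Function.extend e y (fun _ => z i₀) i = ∑ i, g i • y i := by
      intro g y
      symm
      apply Fintype.sum_of_injective e e.injective
      · intro i hi
        rw [Function.extend_apply' _ _ _ (by simpa using hi)]
        simp
      · intro i
        simp [e.injective.extend_apply]
    refine ⟨(Function.extend e w 0, Function.extend e z (fun _ => z i₀)), ⟨⟨?_, ?_⟩, ?_⟩, hext w z⟩
    · intro i
      by_cases h : ∃ a, e a = i
      · obtain ⟨a, rfl⟩ := h
        simpa [e.injective.extend_apply] using (hw a).le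
      · simp [Function.extend_apply' _ _ _ h]
    · rw [← hw1]
      symm
      apply Fintype.sum_of_injective e e.injective
      · intro i hi
        simpa using Function.extend_apply' w (0 : Fin d → ℝ) i (by simpa using hi)
      · intro i
        simp [e.injective.extend_apply]
    · intro i _
      by_cases h : ∃ a, e a = i
      · obtain ⟨a, rfl⟩ := h
        simpa [e.injective.extend_apply] using hz (Set.mem_range_self a)
      · simpa [Function.extend_apply' _ _ _ h] using hz (Set.mem_range_self i₀)
  · rintro _ ⟨⟨w, z⟩, ⟨hw, hz⟩, rfl⟩
    exact (convex_convexHull ℝ s).sum_mem (fun i _ => hw.1 i) hw.2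
      fun i _ => subset_convexHull ℝ s (hz i (Set.mem_univ i))

/-- Points that are affinely independent in a hyperplane missing the origin are linearly
independent. -/
theorem AffineIndependent.linearIndependent_of_eq_one {ι E : Type*} [Fintype ι] [AddCommGroup E]
    [Module ℝ E] {z : ι → E} (hz : AffineIndependent ℝ z) (ℓ : E →ₗ[ℝ] ℝ) (hℓ : ∀ i, ℓ (z i) = 1) :
    LinearIndependent ℝ z := by
  rw [Fintype.linearIndependent_iff]
  intro g hg
  have h0 : ∑ i, g i = 0 := by
    have := congrArg ℓ hg
    simpa [hℓ] using this
  intro i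
  rw [affineIndependent_iff] at hz
  exact hz Finset.univ g h0 hg i (Finset.mem_univ i)

namespace FunctionalJohn

variable {n : ℕ}

/-! ### John's decomposition for a set -/

theorem mem_ellipsoid {c x : EuclideanSpace ℝ (Fin n)} {T : Matrix (Fin n) (Fin n) ℝ} :
    x ∈ ellipsoid c T ↔ ∃ y, ‖y‖ ≤ 1 ∧ c + Matrix.toEuclideanLin T y = x := by
  simp [ellipsoid]

/-- Interior points of K tolerate a small motion, and at contact points the motion x ↦ x + ε(Hx + h)
decreases the norm to first order. Compactness of the ball makes ε uniform. -/
theorem eventually_ellipsoid_subset {K : Set (EuclideanSpace ℝ (Fin n))}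
    (hK : Metric.closedBall 0 1 ⊆ K) (h : EuclideanSpace ℝ (Fin n)) (H : Matrix (Fin n) (Fin n) ℝ)
    (hneg : ∀ u ∈ frontier K ∩ Metric.sphere 0 1,
      inner ℝ (Matrix.toEuclideanLin H u) u + inner ℝ h u < 0) :
    ∀ᶠ ε : ℝ in 𝓝[>] 0, ellipsoid (ε • h) (1 + ε • H) ⊆ K := by
  have hcont : Continuous (Matrix.toEuclideanLin H) := LinearMap.continuous_of_finiteDimensional _
  let y : ℝ × EuclideanSpace ℝ (Fin n) → EuclideanSpace ℝ (Fin n) :=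
    fun p => p.2 + p.1 • (Matrix.toEuclideanLin H p.2 + h)
  have hy : Continuous y := by fun_prop
  have key : ∀ x ∈ Metric.closedBall (0 : EuclideanSpace ℝ (Fin n)) 1,
      ∀ᶠ p : ℝ × EuclideanSpace ℝ (Fin n) in 𝓝 (0, x), 0 < p.1 → ‖p.2‖ ≤ 1 → y p ∈ K := by
    intro x hx
    by_cases hxi : x ∈ interior K
    · have : ∀ᶠ p in 𝓝 ((0 : ℝ), x), y p ∈ K := by
        apply hy.continuousAt.eventually
        have : y (0, x) = x := by simp [y]
        rw [this]
        exact mem_interior_iff_mem_nhds.mp hxi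
      exact this.mono fun p hp _ _ => hp
    · have hxs : x ∈ Metric.sphere (0 : EuclideanSpace ℝ (Fin n)) 1 := by
        rw [mem_sphere_iff_norm]
        by_contra hne
        apply hxi
        have hlt : ‖x - 0‖ < 1 := lt_of_le_of_ne (mem_closedBall_iff_norm.mp hx) hne
        exact interior_maximal (Metric.ball_subset_closedBall.trans hK) Metric.isOpen_ball
          (mem_ball_iff_norm.mpr hlt)
      have hq := hneg x ⟨⟨subset_closure (hK hx), hxi⟩, hxs⟩
      -- Defined so that ‖x + ε(Hx + h)‖² = ‖x‖² + ε q(ε, x).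
      let q : ℝ × EuclideanSpace ℝ (Fin n) → ℝ := fun p =>
        2 * inner ℝ (Matrix.toEuclideanLin H p.2 + h) p.2
          + p.1 * ‖Matrix.toEuclideanLin H p.2 + h‖ ^ 2
      have hqc : Continuous q := by fun_prop
      have hev : ∀ᶠ p in 𝓝 ((0 : ℝ), x), q p < 0 := by
        apply hqc.continuousAt.eventually_lt continuousAt_const
        simp only [q, zero_mul, add_zero, inner_add_left]
        linarith
      refine hev.mono fun p hp h0 h1 => hK ?_
      rw [mem_closedBall_zero_iff]
      have : ‖y p‖ ^ 2 = ‖p.2‖ ^ 2 + p.1 * q p := by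
        simp only [y, q]
        rw [norm_add_sq_real, norm_smul, inner_smul_right, real_inner_comm, mul_pow,
          Real.norm_eq_abs, sq_abs]
        ring
      have h2 : ‖y p‖ ^ 2 ≤ 1 := by
        rw [this]
        nlinarith [mul_pos h0 (neg_pos.mpr hp), norm_nonneg p.2]
      exact (sq_le_one_iff₀ (norm_nonneg _)).mp h2
  have := (isCompact_closedBall (0 : EuclideanSpace ℝ (Fin n)) 1).eventually_forall_of_forall_eventually
    (P := fun ε x => 0 < ε → ‖x‖ ≤ 1 → y (ε, x) ∈ K) key
  filter_upwards [this.filter_mono nhdsWithin_le_nhds, self_mem_nhdsWithin] with ε hε hpos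
  intro z hz
  obtain ⟨x, hx, rfl⟩ := mem_ellipsoid.mp hz
  have := hε x (mem_closedBall_zero_iff.mpr hx) hpos hx
  convert this using 1
  simp only [y, map_add, map_smul, LinearMap.add_apply, LinearMap.smul_apply, smul_add,
    Matrix.toLpLin_one, LinearMap.id_apply]
  abel

theorem inner_toEuclideanLin_self (T : Matrix (Fin n) (Fin n) ℝ) (u : EuclideanSpace ℝ (Fin n)) :
    inner ℝ (Matrix.toEuclideanLin T u) u = ∑ i, ∑ j, T i j * (u i * u j) := by
  simp only [PiLp.inner_apply, Matrix.ofLp_toLpLin, Matrix.toLin'_apply, Matrix.mulVec, dotProduct,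
    RCLike.inner_apply, conj_trivial, Finset.mul_sum]
  exact Finset.sum_congr rfl fun i _ => Finset.sum_congr rfl fun j _ => by ring

/-- The pair `(u ⊗ u, u)` as a vector of coordinates. -/
def tensorPair (u : EuclideanSpace ℝ (Fin n)) : (Fin n × Fin n) ⊕ Fin n → ℝ :=
  Sum.elim (fun p => u p.1 * u p.2) (fun i => u i)

theorem continuous_tensorPair : Continuous (tensorPair (n := n)) := by
  refine continuous_pi fun k => ?_
  rcases k with p | i <;> simp only [tensorPair, Sum.elim_inl, Sum.elim_inr] <;> fun_prop

/-- The pair `(I / n, 0)` as a vector of coordinates. -/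
noncomputable def isotropicPair (n : ℕ) : (Fin n × Fin n) ⊕ Fin n → ℝ :=
  Sum.elim (fun p => if p.1 = p.2 then (1 / n : ℝ) else 0) (fun _ => 0)

/-- Otherwise a separating functional, read as a pair (H, h), is a direction in which the unit ball
can be deformed inside K while its trace grows beyond n. -/
theorem isotropicPair_mem_convexHull (hn : 1 ≤ n) {K : Set (EuclideanSpace ℝ (Fin n))}
    (hK : Metric.closedBall 0 1 ⊆ K) (hmax : ∀ c T, ellipsoid c T ⊆ K → T.trace ≤ n) :
    isotropicPair n ∈ convexHull ℝ (tensorPair '' (frontier K ∩ Metric.sphere 0 1)) := by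
  have hn0 : (n : ℝ) ≠ 0 := by positivity
  have hcomp : IsCompact (frontier K ∩ Metric.sphere (0 : EuclideanSpace ℝ (Fin n)) 1) :=
    (isCompact_sphere 0 1).inter_left isClosed_frontier
  have hclosed := (hcomp.image continuous_tensorPair).convexHull_of_finiteDimensional.isClosed
  by_contra hnot
  obtain ⟨φ, r, h1, h2⟩ := geometric_hahn_banach_closed_point (convex_convexHull ℝ _) hclosed hnot
  have hφ : ∀ w, φ w = ∑ k, w k • φ (fun j => if k = j then 1 else 0) := fun w =>
    LinearMap.pi_apply_eq_sum_univ (φ : _ →ₗ[ℝ] ℝ) w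
  let a : (Fin n × Fin n) ⊕ Fin n → ℝ := fun k => φ (fun j => if k = j then 1 else 0)
  let H₀ : Matrix (Fin n) (Fin n) ℝ := Matrix.of fun i j => a (Sum.inl (i, j))
  let h : EuclideanSpace ℝ (Fin n) := WithLp.toLp 2 fun i => a (Sum.inr i)
  have hu : ∀ u, φ (tensorPair u) = inner ℝ (Matrix.toEuclideanLin H₀ u) u + inner ℝ h u := by
    intro u
    rw [hφ, inner_toEuclideanLin_self, Fintype.sum_sum_type, Fintype.sum_prod_type]
    simp only [tensorPair, Sum.elim_inl, Sum.elim_inr, smul_eq_mul, PiLp.inner_apply,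
      RCLike.inner_apply, conj_trivial, H₀, h, a, Matrix.of_apply]
    congr 1
    exact Finset.sum_congr rfl fun i _ => Finset.sum_congr rfl fun j _ => by ring
  have hI : φ (isotropicPair n) = H₀.trace / n := by
    rw [hφ, Fintype.sum_sum_type, Fintype.sum_prod_type]
    simp only [isotropicPair, Sum.elim_inl, Sum.elim_inr, smul_eq_mul, ite_mul, zero_mul,
      Finset.sum_ite_eq, Finset.mem_univ, if_true, Finset.sum_const_zero, add_zero]
    rw [← Finset.mul_sum, Matrix.trace, one_div,
      div_eq_inv_mul]
    rfl
  -- Subtracting r I shifts the quadratic form by r on unit vectors, so separation at level r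
  -- becomes negativity at contact points and positive trace.
  let H : Matrix (Fin n) (Fin n) ℝ := H₀ - r • (1 : Matrix (Fin n) (Fin n) ℝ)
  have htr : 0 < H.trace := by
    have : H.trace = H₀.trace - r * n := by simp [H, Matrix.trace_smul]
    rw [this]
    rw [hI, lt_div_iff₀ (by positivity)] at h2
    linarith
  have hev := eventually_ellipsoid_subset hK h H (by
    intro u hu'
    have h3 := h1 _ (subset_convexHull ℝ _ ⟨u, hu', rfl⟩)
    rw [hu] at h3
    have h4 : inner ℝ (Matrix.toEuclideanLin H u) u
        = inner ℝ (Matrix.toEuclideanLin H₀ u) u - r := by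
      have h5 : Matrix.toEuclideanLin (1 : Matrix (Fin n) (Fin n) ℝ) u = u := by
        simp
      simp only [H, map_sub, map_smul, LinearMap.sub_apply, LinearMap.smul_apply, h5,
        inner_sub_left, inner_smul_left, real_inner_self_eq_norm_sq]
      rw [mem_sphere_zero_iff_norm.mp hu'.2]
      simp
    linarith)
  obtain ⟨ε, hε, hpos⟩ := (hev.and self_mem_nhdsWithin).exists
  have h6 := hmax _ _ hε
  rw [Matrix.trace_add, Matrix.trace_smul, Matrix.trace_one, Fintype.card_fin] at h6
  have : 0 < ε * H.trace := mul_pos hpos htr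
  rw [smul_eq_mul] at h6
  linarith

theorem card_le_of_linearIndependent_tensorPair {ι : Type*} [Fintype ι]
    {u : ι → EuclideanSpace ℝ (Fin n)} (h : LinearIndependent ℝ fun i => tensorPair (u i)) :
    Fintype.card ι ≤ n * (n + 3) / 2 := by
  -- By symmetry of u ⊗ u only n(n+1)/2 matrix coordinates count; with n more for u this gives
  -- n(n+3)/2.
  let L : (Sym2 (Fin n) ⊕ Fin n → ℝ) →ₗ[ℝ] ((Fin n × Fin n) ⊕ Fin n → ℝ) :=
    LinearMap.funLeft ℝ ℝ (Sum.map (fun p => s(p.1, p.2)) id)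
  let v : ι → (Sym2 (Fin n) ⊕ Fin n → ℝ) := fun i =>
    Sum.elim (fun p => Sym2.lift ⟨fun a b => u i a * u i b, fun a b => mul_comm _ _⟩ p)
      (fun k => u i k)
  have hv : LinearIndependent ℝ v := by
    apply LinearIndependent.of_comp L
    convert h using 1
    funext i
    funext k
    rcases k with p | k <;> simp [L, v, LinearMap.funLeft, tensorPair]
  have := hv.fintype_card_le_finrank
  rw [Module.finrank_fintype_fun_eq_card, Fintype.card_sum, Sym2.card, Fintype.card_fin,
    Nat.choose_two_right] at this
  have h2 : (n + 1) * (n + 1 - 1) / 2 + n = n * (n + 3) / 2 := by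
    have : n * (n + 3) = (n + 1) * (n + 1 - 1) + n * 2 := by
      rw [Nat.add_sub_cancel]; ring
    rw [this, Nat.add_mul_div_right _ _ (by norm_num)]
  omega

/-- John's decomposition of the identity for a set in which the unit ball is an ellipsoid of
maximal trace. -/
theorem exists_john_decomposition (hn : 1 ≤ n) {K : Set (EuclideanSpace ℝ (Fin n))}
    (hK : Metric.closedBall 0 1 ⊆ K) (hmax : ∀ c T, ellipsoid c T ⊆ K → T.trace ≤ n) :
    ∃ (k : ℕ) (u : Fin k → EuclideanSpace ℝ (Fin n)) (w : Fin k → ℝ),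
      n ≤ k ∧ k ≤ n * (n + 3) / 2 ∧ (∀ j, u j ∈ frontier K ∩ Metric.sphere 0 1) ∧
      (∀ j, 0 < w j) ∧ ∑ j, w j = 1 ∧ ∑ j, w j • u j = 0 ∧
      ∑ j, w j • Matrix.vecMulVec (u j).ofLp (u j).ofLp
        = (1 / n : ℝ) • (1 : Matrix (Fin n) (Fin n) ℝ) := by
  have hn0 : (n : ℝ) ≠ 0 := by positivity
  obtain ⟨ι, _, z, w, hz, hind, hw, hw1, hsum⟩ :=
    eq_pos_convex_span_of_mem_convexHull (isotropicPair_mem_convexHull hn hK hmax)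
  choose u hu huz using fun i => hz (Set.mem_range_self i)
  -- The trace equals |u|² = 1 on contact pairs. Linear instead of affine independence saves the
  -- extra point in Carathéodory's bound.
  let ℓ : ((Fin n × Fin n) ⊕ Fin n → ℝ) →ₗ[ℝ] ℝ := ∑ i, LinearMap.proj (Sum.inl (i, i))
  have hlin : LinearIndependent ℝ fun i => tensorPair (u i) := by
    have : (fun i => tensorPair (u i)) = z := funext huz
    rw [this]
    refine hind.linearIndependent_of_eq_one ℓ fun i => ?_
    rw [← huz]
    have h1 := mem_sphere_zero_iff_norm.mp (hu i).2
    have h2 : ‖u i‖ ^ 2 = 1 := by rw [h1]; norm_num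
    rw [EuclideanSpace.norm_sq_eq] at h2
    rw [← h2]
    simp [ℓ, tensorPair, pow_two]
  have hvec : ∑ i, w i • u i = 0 := by
    ext k
    have := congrFun hsum (Sum.inr k)
    simpa [← huz, tensorPair, isotropicPair, Finset.sum_apply] using this
  have hmat : ∑ i, w i • Matrix.vecMulVec (u i).ofLp (u i).ofLp
        = (1 / n : ℝ) • (1 : Matrix (Fin n) (Fin n) ℝ) := by
    ext k l
    have := congrFun hsum (Sum.inl (k, l))
    simpa [← huz, tensorPair, isotropicPair, Finset.sum_apply, Matrix.sum_apply,
      Matrix.vecMulVec_apply, Matrix.one_apply] using this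
  -- The matrix identity gives x = n Σ wᵢ⟨uᵢ, x⟩uᵢ, so the contact points span.
  have hge : n ≤ Fintype.card ι := by
    have hspan : (⊤ : Submodule ℝ (EuclideanSpace ℝ (Fin n))) ≤ Submodule.span ℝ (Set.range u) := by
      intro x _
      have hx : x = (n : ℝ) • ∑ i, (w i * (∑ l, u i l * x l)) • u i := by
        ext k
        have h1 := congrFun (congrArg (fun M => M.mulVec x.ofLp) hmat) k
        have h2 : ∑ i, w i * (u i k * ∑ l, u i l * x l) = (1 / n : ℝ) * x k := by
          simpa [Matrix.sum_mulVec, Matrix.smul_mulVec, Matrix.vecMulVec_mulVec, dotProduct,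
            Finset.sum_apply] using h1
        have h3 : (∑ i, (w i * (∑ l, u i l * x l)) • u i) k = (1 / n : ℝ) * x k := by
          rw [← h2]
          simp only [WithLp.ofLp_sum, Finset.sum_apply, PiLp.smul_apply, smul_eq_mul]
          exact Finset.sum_congr rfl fun i _ => by ring
        rw [PiLp.smul_apply, h3, smul_eq_mul]
        field_simp
      rw [hx]
      exact Submodule.smul_mem _ _ (Submodule.sum_mem _ fun i _ =>
        Submodule.smul_mem _ _ (Submodule.subset_span (Set.mem_range_self i)))
    have h1 := finrank_range_le_card (R := ℝ) u
    rw [Set.finrank, top_le_iff.mp hspan, finrank_top, finrank_euclideanSpace_fin] at h1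
    exact h1
  let e := Fintype.equivFin ι
  refine ⟨Fintype.card ι, u ∘ e.symm, w ∘ e.symm, hge,
    card_le_of_linearIndependent_tensorPair hlin, fun j => hu _, fun j => hw _, ?_, ?_, ?_⟩
  · rw [← hw1]; exact e.symm.sum_comp w
  · rw [← hvec]; exact e.symm.sum_comp fun i => w i • u i
  · rw [← hmat]; exact e.symm.sum_comp fun i => w i • Matrix.vecMulVec (u i).ofLp (u i).ofLp

/-! ### Level sets, volumes and the first-order condition -/

variable {f : EuclideanSpace ℝ (Fin n) → ℝ}

theorem LogConcave.combo_mem_levelSet (hf : LogConcave f) (hpos : 0 < supNorm f) {s t a b : ℝ}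
    (hs : 0 < s) (ht : 0 < t) (ha : 0 < a) (hb : 0 < b) (hab : a + b = 1)
    {x y : EuclideanSpace ℝ (Fin n)} (hx : x ∈ levelSet f s) (hy : y ∈ levelSet f t) :
    a • x + b • y ∈ levelSet f (s ^ a * t ^ b) := by
  have hx' : s * supNorm f ≤ f x := hx
  have hy' : t * supNorm f ≤ f y := hy
  refine le_trans ?_ (hf.2 x y a b ha hb hab)
  calc s ^ a * t ^ b * supNorm f = (s * supNorm f) ^ a * (t * supNorm f) ^ b := by
        rw [Real.mul_rpow hs.le hpos.le, Real.mul_rpow ht.le hpos.le]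
        have : supNorm f ^ a * supNorm f ^ b = supNorm f := by
          rw [← Real.rpow_add hpos, hab, Real.rpow_one]
        linear_combination (-(s ^ a * t ^ b)) * this
    _ ≤ f x ^ a * f y ^ b := by
        have h1 := mul_pos hs hpos
        have h2 := mul_pos ht hpos
        have h3 : 0 ≤ f x := h1.le.trans hx'
        gcongr

theorem charFn_le_iff (hf : ∀ x, 0 ≤ f x) {t : ℝ} {S : Set (EuclideanSpace ℝ (Fin n))} :
    (∀ x, charFn (t * supNorm f) S x ≤ f x) ↔ S ⊆ levelSet f t := by
  constructor
  · intro h x hx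
    simpa [charFn, hx, levelSet] using h x
  · intro h x
    by_cases hx : x ∈ S
    · simpa [charFn, hx, levelSet] using h hx
    · simpa [charFn, hx] using hf x

theorem ellipsoid_zero_one : ellipsoid (0 : EuclideanSpace ℝ (Fin n)) 1 = Metric.closedBall 0 1 := by
  ext x
  simp [mem_ellipsoid]

theorem ellipsoid_zero_smul_one {ρ : ℝ} (hρ : 0 ≤ ρ) :
    ellipsoid (0 : EuclideanSpace ℝ (Fin n)) (ρ • 1) = Metric.closedBall 0 ρ := by
  have h := smul_unitClosedBall_of_nonneg (E := EuclideanSpace ℝ (Fin n)) hρ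
  rw [← h]
  ext x
  simp [mem_ellipsoid, Set.mem_smul_set]

theorem isCompact_ellipsoid (c : EuclideanSpace ℝ (Fin n)) (T : Matrix (Fin n) (Fin n) ℝ) :
    IsCompact (ellipsoid c T) := by
  apply (isCompact_closedBall 0 1).image
  exact continuous_const.add (LinearMap.continuous_of_finiteDimensional _)

theorem volume_ellipsoid (c : EuclideanSpace ℝ (Fin n)) (T : Matrix (Fin n) (Fin n) ℝ) :
    volume (ellipsoid c T)
      = ENNReal.ofReal |T.det| * volume (Metric.closedBall (0 : EuclideanSpace ℝ (Fin n)) 1) := by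
  have h : ellipsoid c T
      = (fun x => c + x) '' (Matrix.toEuclideanLin T '' Metric.closedBall 0 1) := by
    rw [ellipsoid, Set.image_image]
  have hdet : LinearMap.det (Matrix.toEuclideanLin T) = T.det := by
    rw [Matrix.toEuclideanLin, Matrix.toLpLin_eq_toLin, LinearMap.det_toLin]
  rw [h, Set.image_add_left, measure_preimage_add, Measure.addHaar_image_linearMap, hdet]

theorem integral_charFn_ellipsoid (a : ℝ) (c : EuclideanSpace ℝ (Fin n))
    (T : Matrix (Fin n) (Fin n) ℝ) :
    ∫ x, charFn a (ellipsoid c T) x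
      = a * |T.det| * volume.real (Metric.closedBall (0 : EuclideanSpace ℝ (Fin n)) 1) := by
  rw [charFn, integral_indicator_const _ (isCompact_ellipsoid c T).measurableSet, measureReal_def,
    volume_ellipsoid, ENNReal.toReal_mul, ENNReal.toReal_ofReal (abs_nonneg _), smul_eq_mul,
    measureReal_def]
  ring

theorem volume_real_unitBall_pos :
    0 < volume.real (Metric.closedBall (0 : EuclideanSpace ℝ (Fin n)) 1) := by
  rw [measureReal_def]
  exact ENNReal.toReal_pos (Metric.measure_closedBall_pos volume 0 one_pos).ne'
    (isCompact_closedBall 0 1).measure_lt_top.ne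

/-- Maximality of the height `t₀` over the unit ball bounds the determinants of ellipsoids in
level sets. -/
theorem IsMaximalEllipsoidal.mul_abs_det_le (hf : ∀ x, 0 ≤ f x) (hpos : 0 < supNorm f) {t₀ : ℝ}
    (ht₀ : 0 < t₀)
    (hmax : IsMaximalEllipsoidal f (charFn (t₀ * supNorm f) (Metric.closedBall 0 1)))
    {t : ℝ} (ht : 0 < t) {c : EuclideanSpace ℝ (Fin n)} {T : Matrix (Fin n) (Fin n) ℝ}
    (hT : ellipsoid c T ⊆ levelSet f t) : t * |T.det| ≤ t₀ := by
  by_cases hdet : T.det = 0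
  · simpa [hdet] using ht₀.le
  have h := hmax.2.2 _ ⟨t * supNorm f, c, T, mul_pos ht hpos, hdet, rfl⟩ ((charFn_le_iff hf).2 hT)
  rw [← ellipsoid_zero_one, integral_charFn_ellipsoid, integral_charFn_ellipsoid] at h
  have h2 := le_of_mul_le_mul_right h volume_real_unitBall_pos
  rw [Matrix.det_one, abs_one] at h2
  have h3 : (t * |T.det|) * supNorm f ≤ t₀ * supNorm f := by linarith
  exact le_of_mul_le_mul_right h3 hpos

theorem hasDerivAt_det_one_add_smul (M : Matrix (Fin n) (Fin n) ℝ) :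
    HasDerivAt (fun s : ℝ => (1 + s • M).det) M.trace 0 := by
  have h : (fun s : ℝ => (1 + s • M).det) = _ := funext fun s => Matrix.det_one_add_smul s M
  rw [h]
  -- Only the shape 1 + s tr M + p(s) s² matters.
  generalize (1 + (Polynomial.X : Polynomial ℝ) • M.map Polynomial.C).det.divX.divX = p
  have h1 : HasDerivAt (fun s : ℝ => 1 + M.trace * s) M.trace 0 := by
    simpa using ((hasDerivAt_id (0 : ℝ)).const_mul M.trace).const_add 1
  have h2 : HasDerivAt (fun s : ℝ => p.eval s * s ^ 2) 0 0 := by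
    simpa using (p.hasDerivAt 0).fun_mul (hasDerivAt_pow 2 (0 : ℝ))
  simpa using h1.fun_add h2

/-- First-order condition for maximality. -/
theorem IsMaximalEllipsoidal.log_add_trace_le (hf : LogConcave f) (hpos : 0 < supNorm f) {t₀ : ℝ}
    (ht₀ : 0 < t₀)
    (hmax : IsMaximalEllipsoidal f (charFn (t₀ * supNorm f) (Metric.closedBall 0 1)))
    {t : ℝ} (ht : 0 < t) {c : EuclideanSpace ℝ (Fin n)} {T : Matrix (Fin n) (Fin n) ℝ}
    (hT : ellipsoid c T ⊆ levelSet f t) : Real.log (t / t₀) + T.trace ≤ n := by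
  have hball := (charFn_le_iff hf.1).1 hmax.2.1
  let D : ℝ → ℝ := fun s => (1 + s • (T - 1)).det
  have hD : HasDerivAt D (T - 1).trace 0 := hasDerivAt_det_one_add_smul _
  have hD0 : D 0 = 1 := by simp [D]
  have hG : HasDerivAt (fun s => s * Real.log (t / t₀) + Real.log (D s))
      (Real.log (t / t₀) + (T - 1).trace) 0 := by
    have h1 := hD.log (by rw [hD0]; exact one_ne_zero)
    rw [hD0, div_one] at h1
    simpa using ((hasDerivAt_id (0 : ℝ)).mul_const (Real.log (t / t₀))).fun_add h1
  have hDpos : ∀ᶠ s in 𝓝 (0 : ℝ), 0 < D s := by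
    apply hD.continuousAt.eventually
    rw [hD0]
    exact lt_mem_nhds one_pos
  have hle : ∀ᶠ s in 𝓝[>] (0 : ℝ), s * Real.log (t / t₀) + Real.log (D s) ≤ 0 := by
    filter_upwards [hDpos.filter_mono nhdsWithin_le_nhds, Ioo_mem_nhdsGT (one_pos (α := ℝ))]
      with s hs hs1
    -- Each point is (1 - s) x + s (c + T x), with x in the ball at height t₀ and c + T x at height
    -- t.
    have hsub : ellipsoid (s • c) (1 + s • (T - 1)) ⊆ levelSet f (t₀ ^ (1 - s) * t ^ s) := by
      intro z hz
      obtain ⟨x, hx, rfl⟩ := mem_ellipsoid.mp hz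
      have := hf.combo_mem_levelSet hpos ht₀ ht (sub_pos.2 hs1.2) hs1.1 (by ring)
        (hball (mem_closedBall_zero_iff.mpr hx)) (hT (mem_ellipsoid.mpr ⟨x, hx, rfl⟩))
      convert this using 1
      simp only [map_add, map_sub, map_smul, LinearMap.add_apply, LinearMap.sub_apply,
        LinearMap.smul_apply, Matrix.toLpLin_one, LinearMap.id_apply]
      module
    have h1 := hmax.mul_abs_det_le hf.1 hpos ht₀ (by positivity) hsub
    rw [abs_of_pos hs] at h1
    have h2 := Real.log_le_log (mul_pos (by positivity) hs) h1
    rw [Real.log_mul (by positivity) hs.ne', Real.log_mul (by positivity) (by positivity),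
      Real.log_rpow ht₀, Real.log_rpow ht] at h2
    rw [Real.log_div ht.ne' ht₀.ne']
    simp only [D]
    linarith
  have hslope := (hasDerivWithinAt_iff_tendsto_slope' (by simp)).1 (hG.hasDerivWithinAt (s := Ioi 0))
  have h0 : Real.log (t / t₀) + (T - 1).trace ≤ 0 := by
    refine le_of_tendsto hslope ?_
    filter_upwards [hle, self_mem_nhdsWithin] with s hs hs0
    rw [slope_def_field]
    simp only [hD0, zero_mul, Real.log_one, add_zero, sub_zero]
    exact div_nonpos_of_nonpos_of_nonneg hs (le_of_lt hs0)
  rw [Matrix.trace_sub, Matrix.trace_one, Fintype.card_fin] at h0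
  linarith

/-! ### Positive definite matrices -/

open scoped MatrixOrder Matrix.Norms.L2Operator in
/-- Polar decomposition: every ellipsoid has a positive definite matrix. -/
theorem exists_posDef_ellipsoid_eq (c : EuclideanSpace ℝ (Fin n)) {T : Matrix (Fin n) (Fin n) ℝ}
    (hT : T.det ≠ 0) :
    ∃ P : Matrix (Fin n) (Fin n) ℝ, P.PosDef ∧ ellipsoid c T = ellipsoid c P := by
  have hA : (T * T.transpose).PosSemidef := by
    simpa using Matrix.posSemidef_self_mul_conjTranspose T
  let P : Matrix (Fin n) (Fin n) ℝ := CFC.sqrt (T * T.transpose)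
  have hPP : P * P = T * T.transpose := CFC.sqrt_mul_sqrt_self _ hA.nonneg
  have hP0 : P.PosSemidef := Matrix.nonneg_iff_posSemidef.1 (CFC.sqrt_nonneg (T * T.transpose))
  have hdet2 : P.det * P.det = T.det * T.det := by
    rw [← Matrix.det_mul, hPP, Matrix.det_mul, Matrix.det_transpose]
  have hPdet : P.det ≠ 0 := fun h => hT (by simpa [h] using hdet2.symm)
  have hPu : IsUnit P.det := isUnit_iff_ne_zero.2 hPdet
  have hPt : P.transpose = P := by simpa using hP0.isHermitian.eq
  have hPd : P.PosDef := hP0.posDef_iff_isUnit.2 ((Matrix.isUnit_iff_isUnit_det P).2 hPu)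
  refine ⟨P, hPd, ?_⟩
  -- U is orthogonal, hence preserves the ball, and T = P U.
  let U := P⁻¹ * T
  have hPU : P * U = T := Matrix.mul_nonsing_inv_cancel_left _ _ hPu
  have hUU : U * U.transpose = 1 := by
    simp only [U, Matrix.transpose_mul, Matrix.transpose_nonsing_inv, hPt]
    calc P⁻¹ * T * (T.transpose * P⁻¹) = P⁻¹ * (T * T.transpose) * P⁻¹ := by
          simp only [Matrix.mul_assoc]
      _ = 1 := by
          rw [← hPP, ← Matrix.mul_assoc, Matrix.nonsing_inv_mul _ hPu, Matrix.one_mul,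
            Matrix.mul_nonsing_inv _ hPu]
  have hUU' : U.transpose * U = 1 := mul_eq_one_comm.1 hUU
  have hnorm : ∀ V : Matrix (Fin n) (Fin n) ℝ, V.transpose * V = 1 →
      ∀ x, ‖Matrix.toEuclideanLin V x‖ = ‖x‖ := by
    intro V hV x
    have h : ∀ z : EuclideanSpace ℝ (Fin n), ‖z‖ ^ 2 = z.ofLp ⬝ᵥ z.ofLp := by
      intro z
      rw [EuclideanSpace.norm_sq_eq]
      simp [dotProduct, pow_two]
    have h2 : ‖Matrix.toEuclideanLin V x‖ ^ 2 = ‖x‖ ^ 2 := by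
      rw [h, h, Matrix.ofLp_toLpLin, Matrix.toLin'_apply, Matrix.dotProduct_mulVec,
        Matrix.vecMul_mulVec, hV, Matrix.vecMul_one]
    exact (sq_eq_sq₀ (norm_nonneg _) (norm_nonneg _)).1 h2
  ext z
  rw [mem_ellipsoid, mem_ellipsoid]
  constructor
  · rintro ⟨x, hx, rfl⟩
    refine ⟨Matrix.toEuclideanLin U x, by rwa [hnorm U hUU'], ?_⟩
    rw [← LinearMap.comp_apply, ← Matrix.toLpLin_mul, hPU]
  · rintro ⟨x, hx, rfl⟩
    refine ⟨Matrix.toEuclideanLin U.transpose x, by rwa [hnorm _ (by simpa using hUU)], ?_⟩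
    rw [← LinearMap.comp_apply, ← Matrix.toLpLin_mul, ← hPU, Matrix.mul_assoc, hUU, Matrix.mul_one]

theorem log_det_le_trace_sub {P : Matrix (Fin n) (Fin n) ℝ} (hP : P.PosDef) :
    Real.log P.det ≤ P.trace - n := by
  have h1 := hP.isHermitian.det_eq_prod_eigenvalues
  have h2 := hP.isHermitian.trace_eq_sum_eigenvalues
  simp only [RCLike.ofReal_real_eq_id, id] at h1 h2
  rw [h1, h2, Real.log_prod fun i _ => (hP.eigenvalues_pos i).ne']
  have : (n : ℝ) = ∑ _i : Fin n, (1 : ℝ) := by simp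
  rw [this, ← Finset.sum_sub_distrib]
  exact Finset.sum_le_sum fun i _ => Real.log_le_sub_one_of_pos (hP.eigenvalues_pos i)

/-- Equality in log x ≤ x - 1 for every eigenvalue makes them all 1. -/
theorem eq_one_of_log_det_eq {P : Matrix (Fin n) (Fin n) ℝ} (hP : P.PosDef)
    (h : Real.log P.det = P.trace - n) : P = 1 := by
  have h1 := hP.isHermitian.det_eq_prod_eigenvalues
  have h2 := hP.isHermitian.trace_eq_sum_eigenvalues
  simp only [RCLike.ofReal_real_eq_id, id] at h1 h2
  rw [h1, h2, Real.log_prod fun i _ => (hP.eigenvalues_pos i).ne'] at h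
  have h3 : (n : ℝ) = ∑ _i : Fin n, (1 : ℝ) := by simp
  rw [h3, ← Finset.sum_sub_distrib] at h
  have h4 := (Finset.sum_eq_sum_iff_of_le fun i _ =>
    Real.log_le_sub_one_of_pos (hP.eigenvalues_pos i)).1 h
  have h5 : hP.isHermitian.eigenvalues = fun _ => 1 := by
    funext i
    by_contra hne
    exact (Real.log_lt_sub_one_of_pos (hP.eigenvalues_pos i) hne).ne (h4 i (Finset.mem_univ i))
  rw [hP.isHermitian.spectral_theorem, h5]
  have : Matrix.diagonal ((RCLike.ofReal : ℝ → ℝ) ∘ fun _ : Fin n => 1) = 1 := by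
    ext; simp
  rw [this, map_one]

/-! ### The inner radius of the level sets -/

/-- The ball of radius ρ has determinant ρⁿ, so maximality gives ρⁿ exp τ ≤ t₀. -/
theorem innerRadius_exp_le (hn : 1 ≤ n) (hf : LogConcave f) (hpos : 0 < supNorm f) {t₀ : ℝ}
    (ht₀ : 0 < t₀)
    (hmax : IsMaximalEllipsoidal f (charFn (t₀ * supNorm f) (Metric.closedBall 0 1)))
    {τ ρ : ℝ} (hρ : 0 ≤ ρ) (hball : Metric.closedBall 0 ρ ⊆ levelSet f (Real.exp τ)) :
    ρ ≤ Real.exp ((Real.log t₀ - τ) / n) := by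
  have hn0 : (n : ℝ) ≠ 0 := by positivity
  rw [← ellipsoid_zero_smul_one hρ] at hball
  have h := hmax.mul_abs_det_le hf.1 hpos ht₀ (Real.exp_pos τ) hball
  rw [Matrix.det_smul, Matrix.det_one, mul_one, Fintype.card_fin, abs_of_nonneg (by positivity)] at h
  refine le_of_pow_le_pow_left₀ (n := n) (by omega) (Real.exp_pos _).le ?_
  rw [← Real.exp_nat_mul, mul_div_cancel₀ _ hn0, Real.exp_sub, Real.exp_log ht₀,
    le_div_iff₀ (Real.exp_pos τ)]
  linarith

theorem combo_closedBall_subset (hf : LogConcave f) (hpos : 0 < supNorm f) {s t a b ρ σ : ℝ}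
    (hs : 0 < s) (ht : 0 < t) (ha : 0 < a) (hb : 0 < b) (hab : a + b = 1)
    (hρ : 0 ≤ ρ) (hσ : 0 ≤ σ)
    (h1 : Metric.closedBall 0 ρ ⊆ levelSet f s) (h2 : Metric.closedBall 0 σ ⊆ levelSet f t) :
    Metric.closedBall 0 (a * ρ + b * σ) ⊆ levelSet f (s ^ a * t ^ b) := by
  intro z hz
  rw [mem_closedBall_zero_iff] at hz
  obtain h0 | h0 := (by positivity : 0 ≤ a * ρ + b * σ).eq_or_lt
  · have hz0 : z = 0 := norm_le_zero_iff.1 (h0 ▸ hz)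
    have := hf.combo_mem_levelSet hpos hs ht ha hb hab (h1 (Metric.mem_closedBall_self hρ))
      (h2 (Metric.mem_closedBall_self hσ))
    simpa [hz0] using this
  · have hk : ∀ κ : ℝ, 0 ≤ κ → (κ / (a * ρ + b * σ)) • z ∈ Metric.closedBall 0 κ := by
      intro κ hκ
      rw [mem_closedBall_zero_iff, norm_smul, Real.norm_of_nonneg (by positivity), div_mul_eq_mul_div,
        div_le_iff₀ h0]
      gcongr
    have := hf.combo_mem_levelSet hpos hs ht ha hb hab (h1 (hk ρ hρ)) (h2 (hk σ hσ))
    convert this using 1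
    rw [smul_smul, smul_smul, ← add_smul]
    have : a * (ρ / (a * ρ + b * σ)) + b * (σ / (a * ρ + b * σ)) = 1 := by
      field_simp
    rw [this, one_smul]

/-- The inner radius of the level sets is concave on a logarithmic scale. -/
theorem concaveOn_innerRadius_exp (hf : LogConcave f) (hpos : 0 < supNorm f) (hf0 : 0 < f 0)
    (hbdd : ∀ τ, BddAbove {ρ : ℝ | 0 ≤ ρ ∧ Metric.closedBall 0 ρ ⊆ levelSet f (Real.exp τ)}) :
    ConcaveOn ℝ (Iic (Real.log (f 0 / supNorm f)))
      fun τ => innerRadius (levelSet f (Real.exp τ)) := by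
  -- Up to this endpoint the origin lies in the level set, so the supremum is not the default 0 of
  -- an empty set.
  have hne : ∀ τ ∈ Iic (Real.log (f 0 / supNorm f)),
      {ρ : ℝ | 0 ≤ ρ ∧ Metric.closedBall 0 ρ ⊆ levelSet f (Real.exp τ)}.Nonempty := by
    intro τ hτ
    refine ⟨0, le_rfl, ?_⟩
    rw [Metric.closedBall_zero, singleton_subset_iff]
    have := (Real.le_log_iff_exp_le (by positivity)).1 hτ
    exact (le_div_iff₀ hpos).1 this
  refine concaveOn_iff_forall_pos.2 ⟨convex_Iic _, fun x hx y hy a b ha hb hab => ?_⟩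
  have key : ∀ ρ ∈ {ρ : ℝ | 0 ≤ ρ ∧ Metric.closedBall 0 ρ ⊆ levelSet f (Real.exp x)},
      ∀ σ ∈ {ρ : ℝ | 0 ≤ ρ ∧ Metric.closedBall 0 ρ ⊆ levelSet f (Real.exp y)},
      a * ρ + b * σ ≤ innerRadius (levelSet f (Real.exp (a • x + b • y))) := by
    rintro ρ ⟨hρ, h1⟩ σ ⟨hσ, h2⟩
    refine le_csSup (hbdd _) ⟨by positivity, ?_⟩
    have := combo_closedBall_subset hf hpos (Real.exp_pos x) (Real.exp_pos y) ha hb hab hρ hσ h1 h2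
    rwa [← Real.exp_mul, ← Real.exp_mul, ← Real.exp_add, mul_comm x, mul_comm y] at this
  simp only [smul_eq_mul] at key ⊢
  have h1 : ∀ σ ∈ {ρ : ℝ | 0 ≤ ρ ∧ Metric.closedBall 0 ρ ⊆ levelSet f (Real.exp y)},
      a * innerRadius (levelSet f (Real.exp x)) + b * σ
        ≤ innerRadius (levelSet f (Real.exp (a * x + b * y))) := by
    intro σ hσ
    rw [← le_sub_iff_add_le, ← le_div_iff₀' ha]
    refine csSup_le (hne x hx) fun ρ hρ => ?_
    rw [le_div_iff₀' ha, le_sub_iff_add_le]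
    exact key ρ hρ σ hσ
  rw [← le_sub_iff_add_le', ← le_div_iff₀' hb]
  refine csSup_le (hne y hy) fun σ hσ => ?_
  rw [le_div_iff₀' hb, le_sub_iff_add_le']
  exact h1 σ hσ

theorem _root_.HasDerivWithinAt.le_of_hasDerivAt_of_le {R G : ℝ → ℝ} {x d g : ℝ}
    (hR : HasDerivWithinAt R d (Ioi x) x) (hG : HasDerivAt G g x) (hRG : ∀ y, R y ≤ G y)
    (hx : R x = G x) : d ≤ g := by
  refine le_of_tendsto_of_tendsto ((hasDerivWithinAt_iff_tendsto_slope' (by simp)).1 hR)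
    ((hasDerivWithinAt_iff_tendsto_slope' (by simp)).1 (hG.hasDerivWithinAt (s := Ioi x))) ?_
  filter_upwards [self_mem_nhdsWithin] with y hy
  rw [slope_def_field, slope_def_field, hx]
  exact div_le_div_of_nonneg_right (sub_le_sub_right (hRG y) _) (sub_pos.2 (mem_Ioi.1 hy)).le

/-- A concave function touching a differentiable function from below has a left derivative, even
at the right end of its interval. -/
theorem _root_.ConcaveOn.exists_hasDerivWithinAt_Iio_ge {R G : ℝ → ℝ} {a x g : ℝ}
    (hR : ConcaveOn ℝ (Iic a) R) (hxa : x ≤ a) (hG : HasDerivAt G g x) (hRG : ∀ y, R y ≤ G y)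
    (hx : R x = G x) : ∃ d, HasDerivWithinAt R d (Iio x) x ∧ g ≤ d := by
  have hslope : ∀ y < x, slope G x y ≤ slope R x y := by
    intro y hy
    rw [slope_def_field, slope_def_field, hx]
    exact div_le_div_of_nonpos_of_le (sub_neg.2 hy).le (sub_le_sub_right (hRG y) _)
  have hGlim := (hasDerivWithinAt_iff_tendsto_slope' (by simp)).1 (hG.hasDerivWithinAt (s := Iio x))
  obtain ⟨l, hl, hlsub⟩ := mem_nhdsLT_iff_exists_Ioo_subset.1
    (hGlim.eventually (lt_mem_nhds (sub_one_lt g)))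
  have hanti : AntitoneOn (slope R x) (Ioo l x) :=
    (hR.slope_anti hxa).mono fun y hy => ⟨hy.2.le.trans hxa, hy.2.ne⟩
  -- Near x the slopes of R dominate those of G, which tend to g.
  have hbelow : BddBelow (slope R x '' Ioo l x) := by
    refine ⟨g - 1, ?_⟩
    rintro _ ⟨y, hy, rfl⟩
    exact (le_of_lt (hlsub hy)).trans (hslope y hy.2)
  have hlim := hanti.tendsto_nhdsWithin_Ioo_left (nonempty_Ioo.2 hl) hbelow
  refine ⟨_, (hasDerivWithinAt_iff_tendsto_slope' (by simp)).2 hlim,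
    le_of_tendsto_of_tendsto hGlim hlim ?_⟩
  filter_upwards [self_mem_nhdsWithin] with y hy using hslope y hy

/-- The chain rule for τ = log t divides by t₀, which the factor t₀ in the interval for α undoes. -/
theorem _root_.HasDerivWithinAt.comp_log_of_exp {r : ℝ → ℝ} {d t₀ : ℝ} (ht₀ : 0 < t₀) {s s' : Set ℝ}
    (h : HasDerivWithinAt (fun τ => r (Real.exp τ)) d s (Real.log t₀))
    (hs : MapsTo Real.log (s' ∩ Ioi 0) s) : HasDerivWithinAt r (d / t₀) s' t₀ := by
  have h1 : HasDerivWithinAt ((fun τ => r (Real.exp τ)) ∘ Real.log) (d * t₀⁻¹) (s' ∩ Ioi 0) t₀ :=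
    h.comp t₀ (Real.hasDerivAt_log ht₀.ne').hasDerivWithinAt hs
  rw [hasDerivWithinAt_inter (Ioi_mem_nhds ht₀)] at h1
  rw [div_eq_mul_inv]
  refine h1.congr_of_eventuallyEq ?_ (by simp [Real.exp_log ht₀])
  filter_upwards [mem_nhdsWithin_of_mem_nhds (Ioi_mem_nhds ht₀)] with x hx
  simp [Real.exp_log hx]

theorem HasRightDeriv.of_hasDerivWithinAt {g : ℝ → ℝ} {d t : ℝ}
    (h : HasDerivWithinAt g d (Ioi t) t) : HasRightDeriv g d t := by
  have := (hasDerivWithinAt_iff_tendsto_slope' (by simp)).1 h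
  simp only [slope_fun_def_field] at this
  exact (continuous_coe_real_ereal.tendsto d).comp this

theorem HasLeftDeriv.of_hasDerivWithinAt {g : ℝ → ℝ} {d t : ℝ}
    (h : HasDerivWithinAt g d (Iio t) t) : HasLeftDeriv g d t := by
  have := (hasDerivWithinAt_iff_tendsto_slope' (by simp)).1 h
  simp only [slope_fun_def_field] at this
  exact (continuous_coe_real_ereal.tendsto d).comp this

theorem hasRightDeriv_bot {g : ℝ → ℝ} {t : ℝ} (h1 : 0 < g t) (h0 : ∀ s, t < s → g s = 0) :
    HasRightDeriv g ⊥ t := by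
  have h2 : Tendsto (fun s : ℝ => s - t) (𝓝[>] t) (𝓝[>] 0) := by
    refine tendsto_nhdsWithin_iff.2 ⟨?_, ?_⟩
    · have : Tendsto (fun s : ℝ => s - t) (𝓝 t) (𝓝 (t - t)) :=
        (continuous_id.sub continuous_const).tendsto t
      rw [sub_self] at this
      exact this.mono_left nhdsWithin_le_nhds
    · filter_upwards [self_mem_nhdsWithin] with s hs
      exact sub_pos.2 (mem_Ioi.1 hs)
  have h3 : Tendsto (fun s : ℝ => (-g t) * (s - t)⁻¹) (𝓝[>] t) atBot :=
    (tendsto_inv_nhdsGT_zero.comp h2).const_mul_atTop_of_neg (neg_neg_of_pos h1)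
  refine (EReal.tendsto_coe_nhds_bot_iff.2 h3).congr' ?_
  filter_upwards [self_mem_nhdsWithin] with s hs
  rw [h0 s hs, zero_sub, div_eq_mul_inv]

/-- At the height of a maximal unit ball, the one-sided derivatives of the inner radius exist and
enclose `-1 / n` on a logarithmic scale. -/
theorem IsMaximalEllipsoidal.exists_deriv_innerRadius (hn : 1 ≤ n) (hf : LogConcave f)
    (hpos : 0 < supNorm f) {t₀ : ℝ} (ht₀ : 0 < t₀)
    (hmax : IsMaximalEllipsoidal f (charFn (t₀ * supNorm f) (Metric.closedBall 0 1))) :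
    ∃ dR dL : EReal, HasRightDeriv (fun t => innerRadius (levelSet f t)) dR t₀ ∧
      HasLeftDeriv (fun t => innerRadius (levelSet f t)) dL t₀ ∧
      (t₀ : EReal) * dR ≤ ((-1 / n : ℝ) : EReal) ∧ ((-1 / n : ℝ) : EReal) ≤ (t₀ : EReal) * dL := by
  have hn1 : (1 : ℝ) ≤ n := by exact_mod_cast hn
  have hball := (charFn_le_iff hf.1).1 hmax.2.1
  let τ₀ := Real.log t₀
  have hexp : Real.exp τ₀ = t₀ := Real.exp_log ht₀
  let R : ℝ → ℝ := fun τ => innerRadius (levelSet f (Real.exp τ))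
  let G : ℝ → ℝ := fun τ => Real.exp ((τ₀ - τ) / n)
  have hRG : ∀ τ, R τ ≤ G τ := fun τ =>
    Real.sSup_le (fun ρ hρ => innerRadius_exp_le hn hf hpos ht₀ hmax hρ.1 hρ.2) (Real.exp_pos _).le
  have hbdd : ∀ τ, BddAbove {ρ : ℝ | 0 ≤ ρ ∧ Metric.closedBall 0 ρ ⊆ levelSet f (Real.exp τ)} :=
    fun τ => ⟨_, fun ρ hρ => innerRadius_exp_le hn hf hpos ht₀ hmax hρ.1 hρ.2⟩
  have hG0 : G τ₀ = 1 := by simp [G]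
  have hR0 : R τ₀ = 1 := by
    refine le_antisymm (hG0 ▸ hRG τ₀) (le_csSup (hbdd _) ⟨zero_le_one, ?_⟩)
    rwa [hexp]
  have hGd : HasDerivAt G (-1 / n) τ₀ := by
    have := ((((hasDerivAt_id τ₀).const_sub τ₀).div_const (n : ℝ))).exp
    simpa [G] using this
  have h0 : t₀ * supNorm f ≤ f 0 := hball (Metric.mem_closedBall_self zero_le_one)
  have hf0 : 0 < f 0 := (mul_pos ht₀ hpos).trans_le h0
  have hconc : ConcaveOn ℝ (Iic (Real.log (f 0 / supNorm f))) R :=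
    concaveOn_innerRadius_exp hf hpos hf0 hbdd
  have hτmem : τ₀ ≤ Real.log (f 0 / supNorm f) :=
    Real.log_le_log ht₀ ((le_div_iff₀ hpos).2 h0)
  have hmulcoe : ∀ d : ℝ, (t₀ : EReal) * ((d / t₀ : ℝ) : EReal) = (d : EReal) := by
    intro d
    rw [← EReal.coe_mul, mul_div_cancel₀ _ ht₀.ne']
  obtain ⟨dL, hdL, hdLle⟩ :=
    hconc.exists_hasDerivWithinAt_Iio_ge hτmem hGd hRG (hR0.trans hG0.symm)
  have hleft : HasLeftDeriv (fun t => innerRadius (levelSet f t)) ((dL / t₀ : ℝ) : EReal) t₀ :=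
    .of_hasDerivWithinAt (hdL.comp_log_of_exp ht₀ fun x hx =>
      mem_Iio.2 (Real.log_lt_log (mem_Ioi.1 hx.2) (mem_Iio.1 hx.1)))
  have hLle : ((-1 / n : ℝ) : EReal) ≤ (t₀ : EReal) * ((dL / t₀ : ℝ) : EReal) := by
    rw [hmulcoe]
    exact_mod_cast hdLle
  -- If the origin has height exactly t₀, no centred ball survives above t₀: the radius drops from 1
  -- to 0 and the right derivative is -∞. Otherwise log t₀ is interior to the interval of concavity.
  obtain h | h := h0.eq_or_lt
  · refine ⟨⊥, _, hasRightDeriv_bot ?_ ?_, hleft, ?_, hLle⟩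
    · have : innerRadius (levelSet f t₀) = 1 := by rw [← hR0, ← hexp]
      rw [this]
      exact one_pos
    · intro s hs
      have : {ρ : ℝ | 0 ≤ ρ ∧ Metric.closedBall 0 ρ ⊆ levelSet f s} = ∅ := by
        refine eq_empty_of_forall_notMem fun ρ hρ => ?_
        have h1 : s * supNorm f ≤ f 0 := hρ.2 (Metric.mem_closedBall_self hρ.1)
        rw [← h] at h1
        exact absurd (le_of_mul_le_mul_right h1 hpos) (not_le.2 hs)
      rw [innerRadius, this, Real.sSup_empty]
    · rw [EReal.coe_mul_bot_of_pos ht₀]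
      exact bot_le
  · have hint : τ₀ ∈ interior (Iic (Real.log (f 0 / supNorm f))) := by
      rw [interior_Iic]
      exact Real.log_lt_log ht₀ ((lt_div_iff₀ hpos).2 h)
    have hdR := (neg_neg R ▸
      (hconc.neg.differentiableWithinAt_Ioi_of_mem_interior hint).neg).hasDerivWithinAt
    refine ⟨_, _, .of_hasDerivWithinAt (hdR.comp_log_of_exp ht₀ fun x hx =>
      mem_Ioi.2 (Real.log_lt_log ht₀ (mem_Ioi.1 hx.1))), hleft, ?_, hLle⟩
    rw [hmulcoe]
    have := hdR.le_of_hasDerivAt_of_le hGd hRG (hR0.trans hG0.symm)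
    exact_mod_cast this

/-! ### Contact decompositions and the trace inequality -/

theorem inner_toEuclideanLin_eq_trace (T : Matrix (Fin n) (Fin n) ℝ)
    (u : EuclideanSpace ℝ (Fin n)) :
    inner ℝ (Matrix.toEuclideanLin T u) u = (T * Matrix.vecMulVec u.ofLp u.ofLp).trace := by
  rw [inner_toEuclideanLin_self, Matrix.trace]
  simp only [Matrix.diag_apply, Matrix.mul_apply, Matrix.vecMulVec_apply]
  exact Finset.sum_congr rfl fun i _ => Finset.sum_congr rfl fun j _ => by ring

theorem sum_mul_inner_toEuclideanLin {ι : Type*} [Fintype ι] (T : Matrix (Fin n) (Fin n) ℝ)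
    (u : ι → EuclideanSpace ℝ (Fin n)) (w : ι → ℝ) :
    ∑ j, w j * inner ℝ (Matrix.toEuclideanLin T (u j)) (u j)
      = (T * ∑ j, w j • Matrix.vecMulVec (u j).ofLp (u j).ofLp).trace := by
  rw [Matrix.mul_sum, Matrix.trace_sum]
  refine Finset.sum_congr rfl fun j _ => ?_
  rw [inner_toEuclideanLin_eq_trace, Matrix.mul_smul, Matrix.trace_smul, smul_eq_mul]

/-- With weights of sum 1 decomposing I / n, the factor λ = n restores I and α = -1/n makes λα = -1.
The contact inequality is then the trace inequality divided by n, valid for every matrix T. -/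
theorem IsMaximalEllipsoidal.contactDecomposition (hn : 1 ≤ n) (hf : LogConcave f)
    (hpos : 0 < supNorm f) {t₀ : ℝ} (ht₀ : 0 < t₀)
    (hmax : IsMaximalEllipsoidal f (charFn (t₀ * supNorm f) (Metric.closedBall 0 1)))
    (𝒯 : Set (Matrix (Fin n) (Fin n) ℝ)) : ContactDecomposition f t₀ 𝒯 := by
  have hn0 : (0 : ℝ) < n := by exact_mod_cast hn
  have hball := (charFn_le_iff hf.1).1 hmax.2.1
  obtain ⟨dR, dL, hdR, hdL, hR, hL⟩ := hmax.exists_deriv_innerRadius hn hf hpos ht₀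
  obtain ⟨k, u, w, hk1, hk2, hu, hw, hw1, hwu, hwm⟩ :=
    exists_john_decomposition hn hball fun c T hT => by
      simpa [div_self ht₀.ne'] using hmax.log_add_trace_le hf hpos ht₀ ht₀ hT
  refine ⟨1, fun _ => k, fun _ => u, fun _ => n, fun _ => w, fun _ => -1 / n, dR, dL,
    ⟨le_rfl, by omega⟩, fun _ => ⟨hk1, hk2⟩, fun _ => hu, fun _ => hn0, fun _ => hw, hdR, hdL,
    fun _ => ⟨hR, hL⟩, ?_, ?_, ?_, ?_⟩
  · simp [mul_div_cancel₀ _ hn0.ne']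
  · simp only [mul_smul, ← Finset.smul_sum, hwu, smul_zero, Finset.sum_const_zero]
  · simp only [mul_smul, ← Finset.smul_sum, hwm, Finset.univ_unique, Finset.sum_singleton]
    rw [smul_smul, mul_one_div_cancel hn0.ne', one_smul]
  · intro t ht _ _ c T _ hT
    have h := hmax.log_add_trace_le hf hpos ht₀ ht hT
    have h1 : ∑ j, w j * inner ℝ c (u j) = 0 := by
      simp only [← inner_smul_right, ← inner_sum, hwu, inner_zero_right]
    have h2 : ∑ j, w j * inner ℝ (Matrix.toEuclideanLin T (u j)) (u j) = T.trace / n := by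
      rw [sum_mul_inner_toEuclideanLin, hwm]
      rw [Matrix.mul_smul, Matrix.trace_smul, Matrix.mul_one, smul_eq_mul, one_div_mul_eq_div]
    rw [h1, h2, hw1]
    have : -(-1 / (n : ℝ)) * Real.log (t / t₀) + 0 + T.trace / n
        = (Real.log (t / t₀) + T.trace) / n := by ring
    rw [this, div_le_one hn0]
    exact h

/-- In the λ-weighted sum the c-terms cancel, the T-terms give tr T, and the right side is tr I = n
because |u| = 1. -/
theorem ContactDecomposition.log_add_trace_le {t₀ : ℝ} {𝒯 : Set (Matrix (Fin n) (Fin n) ℝ)}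
    (h : ContactDecomposition f t₀ 𝒯) {t : ℝ} (ht : 0 < t) (ht1 : t ≤ 1)
    {c : EuclideanSpace ℝ (Fin n)} {T : Matrix (Fin n) (Fin n) ℝ} (hT : T ∈ 𝒯)
    (hsub : ellipsoid c T ⊆ levelSet f t) : Real.log (t / t₀) + T.trace ≤ n := by
  obtain ⟨m, m', u, lam, mu, α, dR, dL, -, -, hu, hlam, -, -, -, -, hα, hu0, hI, hineq⟩ := h
  have hid : ∀ M : Matrix (Fin n) (Fin n) ℝ,
      ∑ i, lam i * ∑ j, mu i j * inner ℝ (Matrix.toEuclideanLin M (u i j)) (u i j) = M.trace := by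
    intro M
    conv_rhs => rw [← Matrix.mul_one M, hI, Matrix.mul_sum, Matrix.trace_sum]
    refine Finset.sum_congr rfl fun i _ => ?_
    rw [← sum_mul_inner_toEuclideanLin, Finset.mul_sum]
    exact Finset.sum_congr rfl fun j _ => (mul_assoc _ _ _).symm
  have hmu : ∑ i, lam i * ∑ j, mu i j = n := by
    have h1 := hid 1
    rw [Matrix.trace_one, Fintype.card_fin] at h1
    rw [← h1]
    refine Finset.sum_congr rfl fun i _ => ?_
    congr 1
    refine Finset.sum_congr rfl fun j _ => ?_
    rw [Matrix.toLpLin_one, LinearMap.id_apply, real_inner_self_eq_norm_sq,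
      mem_sphere_zero_iff_norm.1 (hu i j).2]
    ring
  have hc : ∑ i, lam i * ∑ j, mu i j * inner ℝ c (u i j) = 0 := by
    simp only [Finset.mul_sum, ← mul_assoc]
    simp only [← inner_smul_right, ← inner_sum, hu0, inner_zero_right]
  have hsum := Finset.sum_le_sum fun i (_ : i ∈ Finset.univ) =>
    mul_le_mul_of_nonneg_left (hineq t ht ht1 i c T hT hsub) (hlam i).le
  rw [hmu] at hsum
  simp only [mul_add, Finset.sum_add_distrib] at hsum
  rw [hid, hc] at hsum
  have hlog : ∑ i, lam i * (-α i * Real.log (t / t₀)) = Real.log (t / t₀) := by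
    have : ∀ i, lam i * (-α i * Real.log (t / t₀)) = -Real.log (t / t₀) * (lam i * α i) :=
      fun i => by ring
    simp only [this, ← Finset.mul_sum, hα]
    ring
  rw [hlog] at hsum
  linarith

/-! ### Maximality and uniqueness -/

/-- An unbounded real supremum defaults to 0, so positivity forces f to be bounded. -/
theorem le_supNorm (hpos : 0 < supNorm f) (x : EuclideanSpace ℝ (Fin n)) : f x ≤ supNorm f := by
  refine le_ciSup ?_ x
  by_contra h
  rw [supNorm, Real.iSup_of_not_bddAbove h] at hpos
  exact hpos.ne rfl

/-- A convex set that contains two translates of the unit ball contains an ellipsoid of larger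
trace than the ball. -/
theorem exists_posDef_ellipsoid_subset_trace_gt (hf : LogConcave f) (hpos : 0 < supNorm f) {t : ℝ}
    (ht : 0 < t) {c : EuclideanSpace ℝ (Fin n)} (hc : c ≠ 0)
    (h0 : Metric.closedBall 0 1 ⊆ levelSet f t) (h1 : ellipsoid c 1 ⊆ levelSet f t) :
    ∃ (c' : EuclideanSpace ℝ (Fin n)) (P : Matrix (Fin n) (Fin n) ℝ),
      P.PosDef ∧ ellipsoid c' P ⊆ levelSet f t ∧ n < P.trace := by
  have hc0 : 0 < ‖c‖ := norm_pos_iff.2 hc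
  let V := Matrix.vecMulVec c.ofLp c.ofLp
  -- Then |δ⟨c, x⟩| ≤ 1/4, so (1/2 + δ⟨c, x⟩)c + x is a genuine convex combination of x and c + x.
  let δ : ℝ := 1 / (4 * ‖c‖)
  have hδ : 0 < δ := by positivity
  have hV : V.PosSemidef := by
    simpa [V] using Matrix.posSemidef_vecMulVec_self_star c.ofLp
  have hVx : ∀ x, Matrix.toEuclideanLin V x = (inner ℝ c x : ℝ) • c := by
    intro x
    ext k
    simp [V, Matrix.ofLp_toLpLin, Matrix.vecMulVec_mulVec, PiLp.inner_apply, dotProduct, mul_comm]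
  refine ⟨(1 / 2 : ℝ) • c, 1 + δ • V, Matrix.PosDef.one.add_posSemidef (hV.smul hδ.le), ?_, ?_⟩
  · intro z hz
    obtain ⟨x, hx, rfl⟩ := mem_ellipsoid.1 hz
    have hin : |δ * inner ℝ c x| ≤ 1 / 4 := by
      rw [abs_mul, abs_of_pos hδ]
      calc δ * |inner ℝ c x| ≤ δ * (‖c‖ * 1) := by
            gcongr
            exact (abs_real_inner_le_norm c x).trans (by gcongr)
        _ = 1 / 4 := by simp only [δ]; field_simp
    obtain ⟨hlo, hhi⟩ := abs_le.1 hin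
    have hmem := hf.combo_mem_levelSet hpos ht ht (a := 1 / 2 - δ * inner ℝ c x)
      (b := 1 / 2 + δ * inner ℝ c x) (by linarith) (by linarith) (by ring)
      (h0 (mem_closedBall_zero_iff.2 hx)) (h1 (mem_ellipsoid.2 ⟨x, hx, rfl⟩))
    rw [← Real.rpow_add ht] at hmem
    have he : 1 / 2 - δ * inner ℝ c x + (1 / 2 + δ * inner ℝ c x) = 1 := by ring
    rw [he, Real.rpow_one] at hmem
    convert hmem using 1
    simp only [map_add, map_smul, LinearMap.add_apply, LinearMap.smul_apply, Matrix.toLpLin_one,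
      LinearMap.id_apply, hVx]
    module
  · have hVt : V.trace = ‖c‖ ^ 2 := by
      rw [EuclideanSpace.norm_sq_eq]
      simp [V, Matrix.trace_vecMulVec, dotProduct, pow_two]
    rw [Matrix.trace_add, Matrix.trace_one, Matrix.trace_smul, Fintype.card_fin, hVt, smul_eq_mul]
    have : 0 < δ * ‖c‖ ^ 2 := by positivity
    linarith

/-- A first-order bound forces the unit ball to be the only maximizer. -/
theorem johnEllipsoid_eq_of_log_add_trace_le (hf : LogConcave f) (hpos : 0 < supNorm f) {t₀ : ℝ}
    (ht₀ : 0 < t₀) (ht₁ : t₀ ≤ 1)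
    (hball : Metric.closedBall (0 : EuclideanSpace ℝ (Fin n)) 1 ⊆ levelSet f t₀)
    (htr : ∀ t, 0 < t → t ≤ 1 → ∀ c, ∀ P : Matrix (Fin n) (Fin n) ℝ, P.PosDef →
      ellipsoid c P ⊆ levelSet f t → Real.log (t / t₀) + P.trace ≤ n) :
    johnEllipsoid f = charFn (t₀ * supNorm f) (Metric.closedBall 0 1) := by
  have key : ∀ g : EuclideanSpace ℝ (Fin n) → ℝ, IsEllipsoidal g → (∀ x, g x ≤ f x) →
      ∫ x, g x ≤ ∫ x : EuclideanSpace ℝ (Fin n), charFn (t₀ * supNorm f) (Metric.closedBall 0 1) x ∧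
      (∫ x, g x = ∫ x : EuclideanSpace ℝ (Fin n), charFn (t₀ * supNorm f) (Metric.closedBall 0 1) x →
        g = charFn (t₀ * supNorm f) (Metric.closedBall 0 1)) := by
    rintro _ ⟨a, c, T, ha, hT, rfl⟩ hg
    obtain ⟨P, hP, hE⟩ := exists_posDef_ellipsoid_eq c hT
    obtain ⟨t, rfl⟩ : ∃ t, a = t * supNorm f := ⟨a / supNorm f, (div_mul_cancel₀ _ hpos.ne').symm⟩
    have ht : 0 < t := pos_of_mul_pos_left ha hpos.le
    have hsub := (charFn_le_iff hf.1).1 hg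
    rw [hE] at hsub ⊢
    have ht1 : t ≤ 1 := by
      have hc : c ∈ ellipsoid c P := mem_ellipsoid.2 ⟨0, by simp, by simp⟩
      have h1 : t * supNorm f ≤ f c := hsub hc
      have h2 := h1.trans (le_supNorm hpos c)
      exact le_of_mul_le_mul_right (by linarith) hpos
    have h1 := htr t ht ht1 c P hP hsub
    have h2 := log_det_le_trace_sub hP
    have hdet := hP.det_pos
    have hlog : Real.log (t * P.det) = Real.log (t / t₀) + Real.log P.det + Real.log t₀ := by
      rw [Real.log_mul ht.ne' hdet.ne', Real.log_div ht.ne' ht₀.ne']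
      ring
    have hκ := volume_real_unitBall_pos (n := n)
    rw [← ellipsoid_zero_one, integral_charFn_ellipsoid, integral_charFn_ellipsoid, Matrix.det_one,
      abs_one, abs_of_pos hdet]
    constructor
    · have h3 : t * P.det ≤ t₀ :=
        (Real.log_le_log_iff (by positivity) ht₀).1 (by rw [hlog]; linarith)
      have h4 : t * supNorm f * P.det ≤ t₀ * supNorm f * 1 := by nlinarith
      exact mul_le_mul_of_nonneg_right h4 hκ.le
    · intro heq
      have h3 := mul_right_cancel₀ hκ.ne' heq
      have h4 : t * P.det = t₀ := mul_right_cancel₀ hpos.ne' (by linarith)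
      rw [h4] at hlog
      have hP1 : P = 1 := eq_one_of_log_det_eq hP (by linarith)
      subst hP1
      have ht' : t = t₀ := by simpa using h4
      subst ht'
      have hc : c = 0 := by
        by_contra hc
        obtain ⟨c', P, hP', hsub', hgt⟩ :=
          exists_posDef_ellipsoid_subset_trace_gt hf hpos ht hc hball hsub
        have := htr t ht ht1 c' P hP' hsub'
        rw [div_self ht.ne', Real.log_one] at this
        linarith
      rw [hc]
  have hell : IsEllipsoidal (charFn (t₀ * supNorm f)
      (Metric.closedBall (0 : EuclideanSpace ℝ (Fin n)) 1)) :=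
    ⟨_, 0, 1, mul_pos ht₀ hpos, by simp, by rw [ellipsoid_zero_one]⟩
  have hle := (charFn_le_iff hf.1).2 hball
  have hmax : IsMaximalEllipsoidal f (charFn (t₀ * supNorm f) (Metric.closedBall 0 1)) :=
    ⟨hell, hle, fun h h1 h2 => (key h h1 h2).1⟩
  have hex : ∃ g, IsMaximalEllipsoidal f g := ⟨_, hmax⟩
  rw [johnEllipsoid, dif_pos hex]
  have hs := hex.choose_spec
  exact (key _ hs.1 hs.2.1).2 (le_antisymm (key _ hs.1 hs.2.1).1 (hs.2.2 _ hell hle))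

theorem isMaximalEllipsoidal_of_johnEllipsoid_eq {g : EuclideanSpace ℝ (Fin n) → ℝ}
    (h : johnEllipsoid f = g) (hg : g ≠ 0) : IsMaximalEllipsoidal f g := by
  by_cases hex : ∃ g, IsMaximalEllipsoidal f g
  · rw [johnEllipsoid, dif_pos hex] at h
    exact h ▸ hex.choose_spec
  · rw [johnEllipsoid, dif_neg hex] at h
    exact absurd h.symm hg

end FunctionalJohn

theorem theorem5 (n : ℕ) (hn : 1 ≤ n) (f : EuclideanSpace ℝ (Fin n) → ℝ)
    (hf : FunctionalJohn.LogConcave f) (hint : MeasureTheory.Integrable f)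
    (hpos : 0 < FunctionalJohn.supNorm f)
    (t₀ : ℝ) (ht₀ : 0 < t₀) (ht₁ : t₀ ≤ 1)
    (hball : ∀ x, FunctionalJohn.charFn (t₀ * FunctionalJohn.supNorm f)
      (Metric.closedBall (0 : EuclideanSpace ℝ (Fin n)) 1) x ≤ f x) :
    List.TFAE [
      FunctionalJohn.johnEllipsoid f =
        FunctionalJohn.charFn (t₀ * FunctionalJohn.supNorm f)
          (Metric.closedBall (0 : EuclideanSpace ℝ (Fin n)) 1),
      FunctionalJohn.ContactDecomposition f t₀ {T | T.det ≠ 0},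
      FunctionalJohn.ContactDecomposition f t₀ {T | T.PosDef}] := by
  tfae_have 1 → 2 := by
    intro h
    refine (FunctionalJohn.isMaximalEllipsoidal_of_johnEllipsoid_eq h fun h0 => ?_).contactDecomposition
      hn hf hpos ht₀ _
    -- The zero function, the default when no maximiser exists, is excluded by the positive value at
    -- the origin.
    have := congrFun h0 0
    simp [FunctionalJohn.charFn, ht₀.ne', hpos.ne'] at this
  tfae_have 2 → 3 := by
    rintro ⟨m, m', u, lam, mu, α, dR, dL, h1, h2, h3, h4, h5, h6, h7, h8, h9, h10, h11, h12⟩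
    exact ⟨m, m', u, lam, mu, α, dR, dL, h1, h2, h3, h4, h5, h6, h7, h8, h9, h10, h11,
      fun t ht ht1 i c T hT => h12 t ht ht1 i c T (Matrix.PosDef.det_pos hT).ne'⟩
  tfae_have 3 → 1 := by
    intro h
    exact FunctionalJohn.johnEllipsoid_eq_of_log_add_trace_le hf hpos ht₀ ht₁
      ((FunctionalJohn.charFn_le_iff hf.1).1 hball)
      fun t ht ht1 c P hP hsub => h.log_add_trace_le ht ht1 hP hsub
  tfae_finish
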